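/- Let $X=(\mathbf{C}_X,\mathrm{Cov}(X))$ be a small site, i.e. a small category $\mathbf{C}_X$ with a Grothendieck topology given by covering sieves. Let $\lambda$ be a regular cardinal and let $\mathbf{K}$ be a locally $\lambda$-presentable category, i.e. a cocomplete category with a set $A$ of $\lambda$-presentable objects such that every object of $\mathbf{K}$ is a $\lambda$-directed (equivalently, $\lambda$-filtered) colimit of objects of $A$. Let $\mathbf{pS}(X,\mathbf{K})=\mathbf{K}^{\mathbf{C}_X^{op}}$ be the category of presheaves on $X$ with values in $\mathbf{K}$, and let $\mathbf{S}(X,\mathbf{K})\subseteq\mathbf{pS}(X,\mathbf{K})$ be the full subcategory of sheaves, i.e. of those presheaves $\mathcal{A}$ for which $$\mathcal{A}(U)\longrightarrow \varprojlim_{(V\to U)\in R}\mathcal{A}(V)$$ is an isomorphism for every $U\in\mathbf{C}_X$ and every covering sieve $R$ over $U$. Then $\mathbf{S}(X,\mathbf{K})$ is a reflective subcategory of $\mathbf{pS}(X,\mathbf{K})$: the inclusion $\mathbf{S}(X,\mathbf{K})\hookrightarrow\mathbf{pS}(X,\mathbf{K})$ has a left adjoint. -/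

import Mathlib

universe w v u

open CategoryTheory Limits Opposite

namespace CategoryTheory

namespace Presheaf

section

variable {C : Type w} [SmallCategory C] {A : Type u} [Category.{v} A] [HasCoproducts.{w} A]

/-! Sheaves form an orthogonality class. Tensor a covering sieve `S` of `X`, and the presheaf
represented by `X`, with an object `M`: maps to `F` are compatible families `M ⟶ F(Y)` over `S`,
resp. maps `M ⟶ F(X)`. Hence orthogonality to the inclusion is the sheaf condition tested on `M`
(`bijective_freeSieveInclusion_comp_iff`). This condition passes to colimits in `M`, so a small
generator suffices. Sources and targets are presentable for a large enough cardinal, and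
`MorphismProperty.isRightAdjoint_ι_isLocal` gives the reflection. -/

/-- The functoriality of `freeYoneda X M` in the object `X`. -/
noncomputable def freeYonedaMap {X Y : C} (f : X ⟶ Y) (M : A) :
    freeYoneda X M ⟶ freeYoneda Y M :=
  freeYonedaHomEquiv.symm (Sigma.ι (fun (_ : X ⟶ Y) ↦ M) f)

lemma freeYonedaHomEquiv_freeYonedaMap_comp {X Y : C} (f : X ⟶ Y) {M : A} {F : Cᵒᵖ ⥤ A}
    (α : freeYoneda Y M ⟶ F) :
    freeYonedaHomEquiv (freeYonedaMap f M ≫ α) = freeYonedaHomEquiv α ≫ F.map f.op := by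
  obtain ⟨α, rfl⟩ := freeYonedaHomEquiv.symm.surjective α
  rw [freeYonedaHomEquiv_comp, Equiv.apply_symm_apply]
  exact (congrArg (· ≫ (freeYonedaHomEquiv.symm α).app (op X))
    (Equiv.apply_symm_apply _ _)).trans (Sigma.ι_desc _ _)

variable (C) in
/-- `freeYoneda X M` as a functor of `X`. -/
noncomputable def freeYonedaFunctor (M : A) : C ⥤ Cᵒᵖ ⥤ A where
  obj X := freeYoneda X M
  map f := freeYonedaMap f M
  map_id X := freeYonedaHomEquiv.injective (by
    have h := freeYonedaHomEquiv_freeYonedaMap_comp (𝟙 X) (𝟙 (freeYoneda X M))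
    rw [Category.comp_id] at h
    rw [h, op_id, Functor.map_id, Category.comp_id])
  map_comp f g := freeYonedaHomEquiv.injective (by
    have h := freeYonedaHomEquiv_freeYonedaMap_comp (f ≫ g) (𝟙 (freeYoneda _ M))
    have h' := freeYonedaHomEquiv_freeYonedaMap_comp g (𝟙 (freeYoneda _ M))
    rw [Category.comp_id] at h h'
    rw [freeYonedaHomEquiv_freeYonedaMap_comp, h, h', op_comp, Functor.map_comp, Category.assoc])

variable [HasColimitsOfSize.{w, w} A] {X : C} (S : Sieve X) (M : A)

/-- The copower of the presheaf attached to a sieve `S` by an object `M`: it is the colimit of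
the presheaves `freeYoneda Y M` over the morphisms `Y ⟶ X` in `S`. -/
noncomputable def freeSieve : Cᵒᵖ ⥤ A :=
  colimit (S.arrows.diagram ⋙ freeYonedaFunctor C M)

/-- The canonical morphism to `freeSieve S M` attached to a morphism in the sieve `S`. -/
noncomputable def ιFreeSieve {Y : C} (f : Y ⟶ X) (hf : S f) :
    freeYoneda Y M ⟶ freeSieve S M :=
  colimit.ι (S.arrows.diagram ⋙ freeYonedaFunctor C M) (S.arrows.categoryMk f hf)

lemma freeYonedaMap_ιFreeSieve {Y Z : C} (f : Y ⟶ X) (hf : S f) (g : Z ⟶ Y) :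
    freeYonedaMap g M ≫ ιFreeSieve S M f hf =
      ιFreeSieve S M (g ≫ f) (S.downward_closed hf g) := by
  let φ : S.arrows.categoryMk (g ≫ f) (S.downward_closed hf g) ⟶
    S.arrows.categoryMk f hf := ObjectProperty.homMk (Over.homMk g rfl)
  exact colimit.w (S.arrows.diagram ⋙ freeYonedaFunctor C M) φ

/-- The morphism induced by the inclusion of a sieve on `X` in the presheaf represented
by `X`. -/
noncomputable def freeSieveInclusion : freeSieve S M ⟶ freeYoneda X M :=
  colimit.desc _ ((freeYonedaFunctor C M).mapCocone S.arrows.cocone)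

lemma ιFreeSieve_freeSieveInclusion {Y : C} (f : Y ⟶ X) (hf : S f) :
    ιFreeSieve S M f hf ≫ freeSieveInclusion S M = freeYonedaMap f M :=
  colimit.ι_desc _ _

variable {S M}

lemma freeYonedaHomEquiv_ιFreeSieve_freeSieveInclusion_comp {F : Cᵒᵖ ⥤ A}
    (α : freeYoneda X M ⟶ F) {Y : C} (f : Y ⟶ X) (hf : S f) :
    freeYonedaHomEquiv (ιFreeSieve S M f hf ≫ freeSieveInclusion S M ≫ α) =
      freeYonedaHomEquiv α ≫ F.map f.op := by
  rw [← freeYonedaHomEquiv_freeYonedaMap_comp, ← ιFreeSieve_freeSieveInclusion _ _ f hf,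
    Category.assoc]

lemma freeSieve_hom_ext {F : Cᵒᵖ ⥤ A} {α β : freeSieve S M ⟶ F}
    (h : ∀ ⦃Y : C⦄ (f : Y ⟶ X) (hf : S f),
      freeYonedaHomEquiv (ιFreeSieve S M f hf ≫ α) =
      freeYonedaHomEquiv (ιFreeSieve S M f hf ≫ β)) : α = β :=
  colimit.hom_ext (fun j ↦ freeYonedaHomEquiv.injective (h j.obj.hom j.property))

/-- A compatible family of morphisms from `M` to the sections of `F` over the sieve `S` is
induced by a morphism `freeSieve S M ⟶ F`. -/
lemma exists_freeSieve_hom {F : Cᵒᵖ ⥤ A}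
    (x : Presieve.FamilyOfElements (F ⋙ coyoneda.obj (op M)) S.arrows) (hx : x.Compatible) :
    ∃ (α : freeSieve S M ⟶ F), ∀ ⦃Y : C⦄ (f : Y ⟶ X) (hf : S f),
      freeYonedaHomEquiv (ιFreeSieve S M f hf ≫ α) = x f hf := by
  let c : Cocone (S.arrows.diagram ⋙ freeYonedaFunctor C M) :=
    { pt := F
      ι :=
        { app j := freeYonedaHomEquiv.symm (x j.obj.hom j.property)
          naturality j k φ := by
            refine Eq.trans ?_ (Category.comp_id _).symm
            refine freeYonedaHomEquiv.injective
              ((freeYonedaHomEquiv_freeYonedaMap_comp φ.hom.left _).trans ?_)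
            rw [Equiv.apply_symm_apply]
            refine (congrArg (· ≫ F.map φ.hom.left.op) (Equiv.apply_symm_apply _ _)).trans ?_
            -- With an identity as second restriction, compatibility becomes naturality over the
            -- category of the sieve.
            have h := hx φ.hom.left (𝟙 _) k.property j.property
              ((Over.w φ.hom).trans (Category.id_comp _).symm)
            dsimp at h
            rwa [F.map_id, Category.comp_id] at h } }
  exact ⟨colimit.desc _ c, fun Y f hf ↦ (congrArg freeYonedaHomEquiv
    (colimit.ι_desc c (S.arrows.categoryMk f hf))).trans (Equiv.apply_symm_apply _ _)⟩

/-- A presheaf `F` satisfies the sheaf condition for a sieve `S` on the sections with source `M`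
if and only if it is orthogonal to `freeSieveInclusion S M`. -/
lemma bijective_freeSieveInclusion_comp_iff (F : Cᵒᵖ ⥤ A) :
    Function.Bijective (fun (α : freeYoneda X M ⟶ F) ↦ freeSieveInclusion S M ≫ α) ↔
      Presieve.IsSheafFor (F ⋙ coyoneda.obj (op M)) S.arrows := by
  refine ⟨fun h x hx ↦ ?_, fun h ↦ ⟨fun α β hαβ ↦ ?_, fun α ↦ ?_⟩⟩
  · obtain ⟨α, hα⟩ := exists_freeSieve_hom x hx
    obtain ⟨β, rfl⟩ := h.2 α
    refine ⟨freeYonedaHomEquiv β, fun Y f hf ↦ ?_, fun t ht ↦ ?_⟩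
    · exact (freeYonedaHomEquiv_ιFreeSieve_freeSieveInclusion_comp β f hf).symm.trans (hα f hf)
    · obtain ⟨γ, rfl⟩ := freeYonedaHomEquiv.surjective t
      congr 1
      refine h.1 (freeSieve_hom_ext (fun Y f hf ↦ ?_))
      exact (freeYonedaHomEquiv_ιFreeSieve_freeSieveInclusion_comp γ f hf).trans
        ((ht f hf).trans (hα f hf).symm)
  · refine freeYonedaHomEquiv.injective (h.isSeparatedFor.ext (fun Y f hf ↦ ?_))
    refine (freeYonedaHomEquiv_ιFreeSieve_freeSieveInclusion_comp α f hf).symm.trans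
      (Eq.trans ?_ (freeYonedaHomEquiv_ιFreeSieve_freeSieveInclusion_comp β f hf))
    dsimp at hαβ
    rw [hαβ]
  · let x : Presieve.FamilyOfElements (F ⋙ coyoneda.obj (op M)) S.arrows := fun Y f hf ↦
      freeYonedaHomEquiv (ιFreeSieve S M f hf ≫ α)
    have hx : x.Compatible := by
      rw [Presieve.compatible_iff_sieveCompatible]
      intro Y Z f g hf
      dsimp only [x]
      rw [← freeYonedaMap_ιFreeSieve, Category.assoc]
      exact freeYonedaHomEquiv_freeYonedaMap_comp g _
    obtain ⟨t, ht, -⟩ := h x hx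
    refine ⟨freeYonedaHomEquiv.symm t, freeSieve_hom_ext (fun Y f hf ↦ ?_)⟩
    refine (freeYonedaHomEquiv_ιFreeSieve_freeSieveInclusion_comp _ f hf).trans ?_
    rw [Equiv.apply_symm_apply]
    exact ht f hf

/-- A `κ`-small colimit of `κ`-presentable objects is `κ`-presentable. -/
lemma isCardinalPresentable_freeSieve [LocallySmall.{w} A] (κ : Cardinal.{w}) [Fact κ.IsRegular]
    [IsCardinalPresentable M κ] (hκ : HasCardinalLT (Arrow S.arrows.category) κ) :
    IsCardinalPresentable (freeSieve S M) κ := by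
  have (j : S.arrows.category) :
      IsCardinalPresentable ((S.arrows.diagram ⋙ freeYonedaFunctor C M).obj j) κ :=
    inferInstanceAs (IsCardinalPresentable (freeYoneda j.obj.left M) κ)
  exact isCardinalPresentable_of_isColimit _
    (colimit.isColimit (S.arrows.diagram ⋙ freeYonedaFunctor C M)) κ hκ

end

section

variable {C : Type w} [Category.{v} C] {A : Type u} [Category A]

/-- The class of objects `E` for which `F ⋙ coyoneda.obj (op E)` satisfies the sheaf condition
is closed under colimits. -/
lemma isSheafFor_comp_coyoneda_of_isColimit (F : Cᵒᵖ ⥤ A) {X : C} (S : Sieve X)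
    {J : Type*} [Category J] {G : J ⥤ A} {c : Cocone G} (hc : IsColimit c)
    (h : ∀ j, Presieve.IsSheafFor (F ⋙ coyoneda.obj (op (G.obj j))) S.arrows) :
    Presieve.IsSheafFor (F ⋙ coyoneda.obj (op c.pt)) S.arrows := by
  intro x hx
  let y (j : J) : Presieve.FamilyOfElements (F ⋙ coyoneda.obj (op (G.obj j))) S.arrows :=
    fun Y f hf ↦ c.ι.app j ≫ x f hf
  have hy (j : J) : (y j).Compatible := fun Y₁ Y₂ Z g₁ g₂ f₁ f₂ h₁ h₂ w ↦ by
    have := hx g₁ g₂ h₁ h₂ w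
    dsimp [y] at this ⊢
    rw [Category.assoc, Category.assoc, this]
  choose t ht ht' using fun j ↦ h j (y j) (hy j)
  -- Uniqueness of amalgamations makes the sections `t j` a cocone.
  let d : Cocone G :=
    { pt := F.obj (op X)
      ι :=
        { app := t
          naturality i j φ := by
            dsimp
            rw [Category.comp_id]
            refine ht' i _ (fun Y f hf ↦ ?_)
            have := ht j f hf
            dsimp [y] at this ⊢
            rw [Category.assoc, this, c.w_assoc] } }
  refine ⟨hc.desc d, fun Y f hf ↦ hc.hom_ext (fun j ↦ ?_), fun s hs ↦ hc.hom_ext (fun j ↦ ?_)⟩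
  · have := ht j f hf
    dsimp at this ⊢
    rw [hc.fac_assoc]
    exact this
  · rw [hc.fac]
    refine ht' j _ (fun Y f hf ↦ ?_)
    have := hs f hf
    dsimp [y] at this ⊢
    rw [Category.assoc, this]

end

section

variable {C : Type w} [SmallCategory C] (J : GrothendieckTopology C)
  {A : Type u} [Category.{v} A] [HasCoproducts.{w} A] [HasColimitsOfSize.{w, w} A]

/-- The inclusions of the covering sieves, tensored with the objects satisfying `P`. -/
def freeSieveInclusions (P : ObjectProperty A) : MorphismProperty (Cᵒᵖ ⥤ A) :=
  .ofHoms (fun (i : (Σ (X : C), {S : Sieve X // S ∈ J X}) × Subtype P) ↦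
    freeSieveInclusion i.1.2.1 i.2.1)

instance (P : ObjectProperty A) [ObjectProperty.Small.{w} P] :
    MorphismProperty.IsSmall.{w} (freeSieveInclusions J P) := by
  unfold freeSieveInclusions
  infer_instance

/-- The sheaves are the presheaves that are orthogonal to the inclusions of covering sieves,
tensored with the objects of a generator. -/
lemma isLocal_freeSieveInclusions {P : ObjectProperty A} {κ : Cardinal.{w}} [Fact κ.IsRegular]
    (hP : P.IsCardinalFilteredGenerator κ) :
    (freeSieveInclusions J P).isLocal = Presheaf.IsSheaf J := by
  ext F
  refine ⟨fun hF E X S hS ↦ ?_, ?_⟩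
  -- `Presheaf.IsSheaf` tests every `E`, locality only those in `P`; write `E` as a colimit of the
  -- latter.
  · obtain ⟨I, _, _, ⟨p⟩⟩ := hP.exists_colimitsOfShape E
    exact isSheafFor_comp_coyoneda_of_isColimit F S p.isColimit (fun i ↦
      (bijective_freeSieveInclusion_comp_iff F).1
        (hF _ (MorphismProperty.ofHoms.mk (ι := (Σ (X : C), {S : Sieve X // S ∈ J X}) × Subtype P)
          (⟨X, S, hS⟩, ⟨_, p.prop_diag_obj i⟩))))
  · rintro hF _ _ _ ⟨⟨⟨X, S, hS⟩, ⟨M, hM⟩⟩⟩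
    exact (bijective_freeSieveInclusion_comp_iff F).2 (hF M S hS)

end

lemma isRightAdjoint_sheafToPresheaf {C : Type w} [SmallCategory C] (J : GrothendieckTopology C)
    (A : Type u) [Category.{v} A] (κ : Cardinal.{w}) [Fact κ.IsRegular]
    [IsCardinalLocallyPresentable A κ] :
    (sheafToPresheaf J A).IsRightAdjoint := by
  obtain ⟨P, _, hP⟩ := HasCardinalFilteredGenerator.exists_small_generator A κ
  -- `κ'` must exceed the number of arrows in the category of each sieve, and also `κ`, which is the
  -- cardinality of `κ.ord.ToType`.
  obtain ⟨κ', hκ', h⟩ := HasCardinalLT.exists_regular_cardinal_forall.{w}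
    (Sum.elim (fun (i : Σ (X : C), Sieve X) ↦ Arrow i.2.arrows.category)
      (fun (_ : Unit) ↦ κ.ord.ToType))
  have : Fact κ'.IsRegular := ⟨hκ'⟩
  have hle : κ ≤ κ' :=
    le_of_lt (by simpa [hasCardinalLT_iff_cardinal_mk_lt] using h (Sum.inr ⟨⟩))
  have : (freeSieveInclusions J P).isLocal.ι.IsRightAdjoint := by
    refine MorphismProperty.isRightAdjoint_ι_isLocal _ κ' ?_
    rintro _ _ _ ⟨⟨⟨X, S, hS⟩, ⟨M, hM⟩⟩⟩
    have : IsCardinalPresentable M κ' :=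
      isCardinalPresentable_monotone _ hle _ (hP.le_isCardinalPresentable _ hM)
    exact ⟨isCardinalPresentable_freeSieve κ' (h (Sum.inl ⟨X, S⟩)), inferInstance⟩
  rwa [isLocal_freeSieveInclusions J hP] at this

end Presheaf

end CategoryTheory

theorem mainTheorem2 {C : Type w} [CategoryTheory.SmallCategory C]
    (J : CategoryTheory.GrothendieckTopology C)
    {K : Type u} [CategoryTheory.Category.{v} K]
    (lam : Cardinal.{w}) [Fact lam.IsRegular]
    [CategoryTheory.IsCardinalLocallyPresentable K lam] :
    Nonempty (CategoryTheory.Reflective (CategoryTheory.sheafToPresheaf J K)) := by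
  have := Presheaf.isRightAdjoint_sheafToPresheaf J K lam
  exact ⟨{ L := _, adj := Adjunction.ofIsRightAdjoint _ }⟩
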